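/- Let $\Omega\subset\mathbb R^N$ be a bounded connected open set with Lipschitz continuous boundary, let $f:\Omega\times\mathbb R^N\to\overline{\mathbb R}=[-\infty,+\infty]$ be a Borel function, and let $F:W^{1,\infty}(\Omega)\to\overline{\mathbb R}$ be the supremal functional $$F(u)=\operatorname*{ess\,sup}_{x\in\Omega} f(x,Du(x)).$$ Assume that there is a sequence $(u_n)_{n\in\mathbb N}\subset W^{1,\infty}(\Omega)$ such that, with $u_\xi(x):=\xi\cdot x$ for $\xi\in\mathbb R^N$, $$\lim_{n\to\infty}F(u_n)=\inf_{W^{1,\infty}(\Omega)}F\ \ (\in\overline{\mathbb R}),\qquad \limsup_{\xi\to0}F(u_n+u_\xi)=F(u_n)\quad\text{for every } n\in\mathbb N.$$ (The value at $\xi=0$ is admitted in the $\limsup$, so that the second condition says that $\xi\mapsto F(u_n+u_\xi)$ is upper semicontinuous at $\xi=0$.) Let $\tau_\infty$ be the topology on $W^{1,\infty}(\Omega)$ induced by the inclusion $W^{1,\infty}(\Omega)\subset L^\infty(\Omega)$; let $w^*$ be the topology that $W^{1,\infty}(\Omega)$ inherits through $u\mapsto(u,Du)$ from $L^\infty(\Omega)\times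 L^\infty(\Omega;\mathbb R^N)$ endowed with the weak* topology as the dual of $L^1(\Omega)\times L^1(\Omega;\mathbb R^N)$; and let $w^*_{seq}$ be the topology whose closed sets are the sequentially $w^*$-closed sets. If $F$ is lower semicontinuous with respect to at least one of $\tau_\infty$, $w^*$, $w^*_{seq}$ (that is, for every $\lambda\in\mathbb R$ the set $\{u: F(u)\le\lambda\}$ is closed in that topology), then $F$ is level convex: $$F(\theta u+(1-\theta)v)\le\max\{F(u),F(v)\}\qquad\text{for all } u,v\in W^{1,\infty}(\Omega),\ \theta\in(0,1).$$ -/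

import Mathlib

open MeasureTheory Filter Topology

noncomputable section

namespace Supremal

/-- Euclidean space `ℝ^N` with the Euclidean norm. -/
abbrev Euc (N : ℕ) : Type := EuclideanSpace ℝ (Fin N)

/-- `Ω` has Lipschitz continuous boundary: near every boundary point, `Ω` is, in suitable
orthonormal coordinates (with "vertical" unit direction `e`), the strict epigraph of a Lipschitz
function of the coordinates orthogonal to `e`; the argument `y - ⟪e, y⟫ e` is the orthogonal
projection of `y` onto the hyperplane orthogonal to `e`. -/
def HasLipschitzBoundary {N : ℕ} (Ω : Set (Euc N)) : Prop :=
  ∀ x₀ ∈ frontier Ω, ∃ r > (0 : ℝ), ∃ e : Euc N, ‖e‖ = 1 ∧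
    ∃ (K : NNReal) (γ : Euc N → ℝ), LipschitzWith K γ ∧
      ∀ y ∈ Metric.ball x₀ r, (y ∈ Ω ↔ γ (y - (inner ℝ e y : ℝ) • e) < inner ℝ e y)

/-- `g` is the weak (distributional) gradient of `u` on `Ω`. -/
def IsWeakGradient {N : ℕ} (Ω : Set (Euc N)) (u : Euc N → ℝ) (g : Euc N → Euc N) : Prop :=
  ∀ φ : Euc N → ℝ, ContDiff ℝ (⊤ : ℕ∞) φ → HasCompactSupport φ → tsupport φ ⊆ Ω →
    ∀ v : Euc N,
      ∫ x in Ω, u x * fderiv ℝ φ x v = - ∫ x in Ω, (inner ℝ (g x) v : ℝ) * φ x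

/-- `L^∞(Ω; G)`, with its norm topology (essential uniform convergence). -/
abbrev Linfty {N : ℕ} (Ω : Set (Euc N)) (G : Type) [NormedAddCommGroup G] : Type :=
  Lp G (⊤ : ENNReal) (volume.restrict Ω)

theorem integrable_mul_of_Linfty {N : ℕ} {Ω : Set (Euc N)} (u : Linfty Ω ℝ)
    {ψ : Euc N → ℝ} (hψ : Continuous ψ) (hc : HasCompactSupport ψ) :
    Integrable (fun x => u x * ψ x) (volume.restrict Ω) :=
  ((hψ.integrable_of_hasCompactSupport hc).restrict).mul_of_top_right (Lp.memLp u)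

theorem integrable_inner_mul_of_Linfty {N : ℕ} {Ω : Set (Euc N)} (g : Linfty Ω (Euc N))
    (v : Euc N) {ψ : Euc N → ℝ} (hψ : Continuous ψ) (hc : HasCompactSupport ψ) :
    Integrable (fun x => (inner ℝ (g x) v : ℝ) * ψ x) (volume.restrict Ω) :=
  ((hψ.integrable_of_hasCompactSupport hc).restrict).mul_of_top_right
    ((Lp.memLp g).inner_const v)

theorem continuous_fderiv_apply_of_smooth {N : ℕ} {φ : Euc N → ℝ}
    (hφ : ContDiff ℝ (⊤ : ℕ∞) φ) (v : Euc N) : Continuous (fun x => fderiv ℝ φ x v) :=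
  (hφ.continuous_fderiv (by simp)).clm_apply continuous_const

theorem hasCompactSupport_fderiv_apply {N : ℕ} {φ : Euc N → ℝ}
    (hc : HasCompactSupport φ) (v : Euc N) : HasCompactSupport (fun x => fderiv ℝ φ x v) :=
  hc.fderiv_apply ℝ v

/-- The Sobolev space `W^{1,∞}(Ω)`, realised as the subspace of `L^∞(Ω) × L^∞(Ω; ℝ^N)` of the
pairs `(u, Du)` in which `Du` is the weak gradient of `u`. On an open set the second component is
determined by the first one (`W1infty.ext_fst`). -/
def W1infty {N : ℕ} (Ω : Set (Euc N)) : Submodule ℝ (Linfty Ω ℝ × Linfty Ω (Euc N)) where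
  carrier := {p | IsWeakGradient Ω p.1 p.2}
  zero_mem' := by
    intro φ _ _ _ v
    have h1 : ∫ x in Ω, (0 : Linfty Ω ℝ) x * fderiv ℝ φ x v = 0 := by
      rw [← integral_zero (Euc N) ℝ (μ := volume.restrict Ω)]
      refine integral_congr_ae ?_
      filter_upwards [Lp.coeFn_zero ℝ (⊤ : ENNReal) (volume.restrict Ω)] with x hx
      rw [hx, Pi.zero_apply, zero_mul]
    have h2 : ∫ x in Ω, (inner ℝ ((0 : Linfty Ω (Euc N)) x) v : ℝ) * φ x = 0 := by
      rw [← integral_zero (Euc N) ℝ (μ := volume.restrict Ω)]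
      refine integral_congr_ae ?_
      filter_upwards [Lp.coeFn_zero (Euc N) (⊤ : ENNReal) (volume.restrict Ω)] with x hx
      rw [hx, Pi.zero_apply, inner_zero_left, zero_mul]
    exact h1.trans (by rw [← neg_zero, ← h2]; rfl)
  add_mem' := by
    rintro ⟨u, g⟩ ⟨u', g'⟩ hp hq φ hφ hc hs v
    have hd := continuous_fderiv_apply_of_smooth hφ v
    have hdc := hasCompactSupport_fderiv_apply hc v
    have h1 : ∫ x in Ω, (u + u') x * fderiv ℝ φ x v
        = (∫ x in Ω, u x * fderiv ℝ φ x v) + ∫ x in Ω, u' x * fderiv ℝ φ x v := by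
      rw [← integral_add (integrable_mul_of_Linfty u hd hdc)
        (integrable_mul_of_Linfty u' hd hdc)]
      refine integral_congr_ae ?_
      filter_upwards [Lp.coeFn_add u u'] with x hx
      rw [hx, Pi.add_apply, add_mul]
    have h2 : ∫ x in Ω, (inner ℝ ((g + g') x) v : ℝ) * φ x
        = (∫ x in Ω, (inner ℝ (g x) v : ℝ) * φ x)
          + ∫ x in Ω, (inner ℝ (g' x) v : ℝ) * φ x := by
      rw [← integral_add (integrable_inner_mul_of_Linfty g v hφ.continuous hc)
        (integrable_inner_mul_of_Linfty g' v hφ.continuous hc)]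
      refine integral_congr_ae ?_
      filter_upwards [Lp.coeFn_add g g'] with x hx
      rw [hx, Pi.add_apply, inner_add_left, add_mul]
    have e1 := hp φ hφ hc hs v
    have e2 := hq φ hφ hc hs v
    dsimp only at e1 e2
    change ∫ x in Ω, (u + u') x * fderiv ℝ φ x v
      = - ∫ x in Ω, (inner ℝ ((g + g') x) v : ℝ) * φ x
    rw [h1, h2, e1, e2]
    ring
  smul_mem' := by
    rintro c ⟨u, g⟩ hp φ hφ hc hs v
    have h1 : ∫ x in Ω, (c • u) x * fderiv ℝ φ x v
        = c * ∫ x in Ω, u x * fderiv ℝ φ x v := by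
      rw [← integral_const_mul]
      refine integral_congr_ae ?_
      filter_upwards [Lp.coeFn_smul c u] with x hx
      simp [hx, mul_assoc]
    have h2 : ∫ x in Ω, (inner ℝ ((c • g) x) v : ℝ) * φ x
        = c * ∫ x in Ω, (inner ℝ (g x) v : ℝ) * φ x := by
      rw [← integral_const_mul]
      refine integral_congr_ae ?_
      filter_upwards [Lp.coeFn_smul c g] with x hx
      simp [hx, mul_assoc, inner_smul_left]
    have e1 := hp φ hφ hc hs v
    dsimp only at e1
    change ∫ x in Ω, (c • u) x * fderiv ℝ φ x v
      = - ∫ x in Ω, (inner ℝ ((c • g) x) v : ℝ) * φ x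
    rw [h1, h2, e1]
    ring

/-- The function `u ∈ L^∞(Ω)` underlying an element of `W^{1,∞}(Ω)`. -/
def fn {N : ℕ} {Ω : Set (Euc N)} (u : W1infty Ω) : Linfty Ω ℝ := u.1.1

/-- The weak gradient `Du ∈ L^∞(Ω; ℝ^N)`. -/
def grad {N : ℕ} {Ω : Set (Euc N)} (u : W1infty Ω) : Linfty Ω (Euc N) := u.1.2

/-- On an open set, an element of `W^{1,∞}(Ω)` is determined by the underlying function. -/
theorem W1infty.ext_fst {N : ℕ} {Ω : Set (Euc N)} (hΩ : IsOpen Ω) {u w : W1infty Ω}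
    (h : fn u = fn w) : u = w := by
  have key : (u - w).1.2 = 0 := by
    have h0 : (u - w).1.1 = 0 := sub_eq_zero.2 h
    generalize u - w = z at h0
    obtain ⟨⟨a, g⟩, hz⟩ := z
    dsimp only at h0 ⊢
    subst h0
    have hcomp : ∀ v : Euc N, ∀ᵐ x ∂(volume.restrict Ω), (inner ℝ (g x) v : ℝ) = 0 := by
      intro v
      rw [ae_restrict_iff' hΩ.measurableSet]
      have hm : MemLp (fun x => (inner ℝ (g x) v : ℝ)) ⊤ (volume.restrict Ω) :=
        (Lp.memLp g).inner_const v
      refine hΩ.ae_eq_zero_of_integral_contDiff_smul_eq_zero ?_ ?_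
      · exact locallyIntegrableOn_of_locallyIntegrable_restrict (hm.locallyIntegrable le_top)
      · intro φ hφ hc hs
        have e := hz φ hφ hc hs v
        have h1 : ∫ x in Ω, (0 : Linfty Ω ℝ) x * fderiv ℝ φ x v = 0 := by
          rw [← integral_zero (Euc N) ℝ (μ := volume.restrict Ω)]
          refine integral_congr_ae ?_
          filter_upwards [Lp.coeFn_zero ℝ (⊤ : ENNReal) (volume.restrict Ω)] with x hx
          rw [hx, Pi.zero_apply, zero_mul]
        dsimp only at e
        rw [h1] at e
        have e' : ∫ x in Ω, (inner ℝ (g x) v : ℝ) * φ x = 0 := by linarith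
        rw [setIntegral_eq_integral_of_forall_compl_eq_zero] at e'
        · simpa [mul_comm] using e'
        · intro x hx
          rw [image_eq_zero_of_notMem_tsupport (fun hx' => hx (hs hx')), mul_zero]
    rw [Lp.eq_zero_iff_ae_eq_zero]
    have hall := ae_all_iff.2 fun i : Fin N => hcomp (EuclideanSpace.single i (1 : ℝ))
    filter_upwards [hall] with x hx
    ext i
    simpa [EuclideanSpace.inner_single_right] using hx i
  refine Subtype.ext (Prod.ext h ?_)
  exact sub_eq_zero.1 key

theorem memLp_linear {N : ℕ} {Ω : Set (Euc N)} (hΩ : Bornology.IsBounded Ω) (ξ : Euc N) :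
    MemLp (fun x : Euc N => (inner ℝ ξ x : ℝ)) ⊤ (volume.restrict Ω) := by
  obtain ⟨R, hR⟩ := hΩ.subset_closedBall (0 : Euc N)
  refine memLp_top_of_bound (by fun_prop) (‖ξ‖ * R) ?_
  refine ae_restrict_of_ae_restrict_of_subset hR ?_
  filter_upwards [ae_restrict_mem Metric.isClosed_closedBall.measurableSet] with x hx
  refine (norm_inner_le_norm ξ x).trans ?_
  gcongr
  simpa using hx

/-- The element `u_ξ(x) = ξ · x` of `W^{1,∞}(Ω)`, for a bounded set `Ω`; its weak gradient is the
constant `ξ`. -/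
def W1infty.linear {N : ℕ} {Ω : Set (Euc N)} (hΩ : Bornology.IsBounded Ω) (ξ : Euc N) :
    W1infty Ω :=
  haveI : IsFiniteMeasure (volume.restrict Ω) := ⟨by simpa using hΩ.measure_lt_top⟩
  ⟨((memLp_linear hΩ ξ).toLp _, (memLp_const (p := ⊤) (μ := volume.restrict Ω) ξ).toLp _), by
    intro φ hφ hc hs v
    have h1 : ∫ x in Ω, (memLp_linear hΩ ξ).toLp _ x * fderiv ℝ φ x v
        = ∫ x in Ω, (inner ℝ ξ x : ℝ) * fderiv ℝ φ x v := by
      refine integral_congr_ae ?_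
      filter_upwards [(memLp_linear hΩ ξ).coeFn_toLp] with x hx
      rw [hx]
    have h2 : ∫ x in Ω, (inner ℝ ((memLp_const (p := ⊤)
          (μ := volume.restrict Ω) ξ).toLp _ x) v : ℝ) * φ x
        = ∫ x in Ω, (inner ℝ ξ v : ℝ) * φ x := by
      refine integral_congr_ae ?_
      filter_upwards [(memLp_const (p := ⊤) (μ := volume.restrict Ω) ξ).coeFn_toLp] with x hx
      rw [hx]
    dsimp only
    rw [h1, h2]
    have z1 : ∀ x, x ∉ Ω → (inner ℝ ξ x : ℝ) * fderiv ℝ φ x v = 0 := by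
      intro x hx
      have : fderiv ℝ φ x = 0 := by
        by_contra hne
        exact hx (hs (support_fderiv_subset ℝ hne))
      simp [this]
    have z2 : ∀ x, x ∉ Ω → (inner ℝ ξ v : ℝ) * φ x = 0 := by
      intro x hx
      rw [image_eq_zero_of_notMem_tsupport (fun hx' => hx (hs hx')), mul_zero]
    rw [setIntegral_eq_integral_of_forall_compl_eq_zero z1,
      setIntegral_eq_integral_of_forall_compl_eq_zero z2]
    have hd := continuous_fderiv_apply_of_smooth hφ v
    have hdc := hasCompactSupport_fderiv_apply hc v
    have hξ : ∀ x : Euc N, fderiv ℝ (fun y : Euc N => (inner ℝ ξ y : ℝ)) x v = inner ℝ ξ v := by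
      intro x
      exact congrArg (fun L : Euc N →L[ℝ] ℝ => L v) (innerSL ℝ ξ).fderiv
    have hcont : Continuous fun x : Euc N => (inner ℝ ξ x : ℝ) := by fun_prop
    have := integral_mul_fderiv_eq_neg_fderiv_mul_of_integrable (μ := (volume : Measure (Euc N)))
      (f := fun y : Euc N => (inner ℝ ξ y : ℝ)) (g := φ) (v := v)
      (by
        simp only [hξ]
        exact (hφ.continuous.integrable_of_hasCompactSupport hc).const_mul _)
      ((hcont.mul hd).integrable_of_hasCompactSupport hdc.mul_left)
      ((hcont.mul hφ.continuous).integrable_of_hasCompactSupport hc.mul_left)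
      (fun x _ => (innerSL ℝ ξ).differentiableAt)
      (fun x _ => (hφ.differentiable (by simp)).differentiableAt)
    simpa only [hξ] using this⟩

/-- The supremal functional `F(u) = ess sup_{x ∈ Ω} f(x, Du(x))`. -/
def supremalFunctional {N : ℕ} (Ω : Set (Euc N)) (f : Euc N × Euc N → EReal)
    (u : W1infty Ω) : EReal :=
  essSup (fun x => f (x, grad u x)) (volume.restrict Ω)

/-- The topology `τ_∞` on `W^{1,∞}(Ω)`, induced by the inclusion into `L^∞(Ω)`. -/
abbrev uniformTopology {N : ℕ} (Ω : Set (Euc N)) : TopologicalSpace (W1infty Ω) :=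
  TopologicalSpace.induced fn inferInstance

/-- The weak* topology of `L^∞(Ω; G)` as the dual of `L^1(Ω; G)`: the coarsest topology for which
all pairings `u ↦ ∫_Ω ⟪g, u⟫` with `g ∈ L^1(Ω; G)` are continuous. -/
abbrev weakStarLinfty {N : ℕ} (Ω : Set (Euc N)) (G : Type) [NormedAddCommGroup G]
    [InnerProductSpace ℝ G] : TopologicalSpace (Linfty Ω G) :=
  ⨅ g : Lp G 1 (volume.restrict Ω),
    TopologicalSpace.induced (fun u : Linfty Ω G => ∫ x in Ω, (inner ℝ (g x) (u x) : ℝ))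
      inferInstance

/-- The weak* topology `w^*` on `W^{1,∞}(Ω)`, inherited from `L^∞(Ω) × L^∞(Ω; ℝ^N)`, where both
factors carry their weak* topologies. -/
abbrev weakStarTopology {N : ℕ} (Ω : Set (Euc N)) : TopologicalSpace (W1infty Ω) :=
  TopologicalSpace.induced fn (weakStarLinfty Ω ℝ) ⊓
    TopologicalSpace.induced grad (weakStarLinfty Ω (Euc N))

/-- The topology whose closed sets are the sequentially closed sets of `τ`. -/
abbrev sequentialTopology {X : Type} (τ : TopologicalSpace X) : TopologicalSpace X :=
  TopologicalSpace.ofClosed {s | @IsSeqClosed X τ s}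
    (fun _ _ h _ => h 0)
    (fun _ hA _ _ hx hp s hs => hA hs (fun n => hx n s hs) hp)
    (by
      intro A hA B hB x p hx hp
      by_cases hfr : ∃ᶠ n in atTop, x n ∈ A
      · obtain ⟨φ, hφ, hφA⟩ := extraction_of_frequently_atTop hfr
        exact Or.inl (hA hφA (hp.comp hφ.tendsto_atTop))
      · have hev : ∀ᶠ n in atTop, x n ∈ B := by
          filter_upwards [not_frequently.1 hfr] with n hn
          exact (hx n).resolve_left hn
        obtain ⟨φ, hφ, hφB⟩ := extraction_of_frequently_atTop hev.frequently
        exact Or.inr (hB hφB (hp.comp hφ.tendsto_atTop)))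

/-- Hypothesis `(H_Ω)` on a functional `F` on `W^{1,∞}(Ω)`: there is a minimizing sequence `(u_n)`
(in the extended reals) such that `limsup_{ξ → 0} F(u_n + u_ξ) = F(u_n)` for every `n`. -/
def HasContinuousMinimizingSequence {N : ℕ} {Ω : Set (Euc N)} (hΩ : Bornology.IsBounded Ω)
    (F : W1infty Ω → EReal) : Prop :=
  ∃ u : ℕ → W1infty Ω,
    Tendsto (fun n => F (u n)) atTop (𝓝 (⨅ w : W1infty Ω, F w)) ∧
    ∀ n, limsup (fun ξ : Euc N => F (u n + W1infty.linear hΩ ξ)) (𝓝 0) = F (u n)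

/-- `F` is lower semicontinuous for the topology `τ`: its sublevel sets are `τ`-closed. -/
def IsLSC {X : Type} (τ : TopologicalSpace X) (F : X → EReal) : Prop :=
  ∀ t : ℝ, IsClosed[τ] {x | F x ≤ (t : EReal)}

/-- `F` is level convex. -/
def LevelConvex {X : Type} [AddCommGroup X] [Module ℝ X] (F : X → EReal) : Prop :=
  ∀ θ : ℝ, 0 < θ → θ < 1 → ∀ x y : X, F (θ • x + (1 - θ) • y) ≤ max (F x) (F y)

end Supremal

end

/-!
The functional is level convex because, for scalar functions, every point of a segment `[v, u]` in
`W^{1,∞}(Ω)` is a limit of functions whose gradients take only the values of `Du` and `Dv`. Let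
`E ⊆ ℝ` be closed, `1`-periodic and of density `θ`, and let `K s = ∫ t in 0..s, 1_E t`, so that
`|K s - θ s|` is bounded (`exists_isClosed_abs_integral_indicator_sub_le`). Put, for `n ≥ 1`,
  `w_n = v + n⁻¹ K (n (u - v))`.
Then `w_n → v + θ (u - v)` uniformly, at rate `1 / n`, while by the chain rule
  `Dw_n = Dv + 1_E (n (u - v)) (Du - Dv)`,
which equals `Du` or `Dv` almost everywhere (`exists_seq_grad_eq_or_eq`). Hence
`F (w_n) ≤ max (F u) (F v)`, and lower semicontinuity carries the bound over to the limit. This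
applies to each of the three topologies, because a uniformly convergent sequence with bounded
gradients also converges weakly* (`tendsto_weakStarTopology`).

The chain rule for the Lipschitz function `K` is the only delicate point, since `K` is not
differentiable at the boundary points of `E`. It holds with the everywhere defined function `1_E` in
the place of `K'`: for `C¹` outer functions it follows by mollification
(`IsWeakDeriv.comp_of_hasDerivAt`), and `1_E` is a bounded pointwise limit of continuous functions
because `E` is closed (`IsWeakDeriv.comp_integral_indicator`).
-/

/-! ### Essential bounds -/

theorem MeasureTheory.MemLp.ae_norm_le {α E : Type*} [MeasurableSpace α]
    [NormedAddCommGroup E] {μ : Measure α} {f : α → E} (hf : MemLp f ⊤ μ) :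
    ∀ᵐ x ∂μ, ‖f x‖ ≤ (eLpNorm f ⊤ μ).toReal := by
  have h := hf.2.ne
  rw [eLpNorm_exponent_top] at h ⊢
  filter_upwards [ae_le_eLpNormEssSup (f := f) (μ := μ)] with x hx
  rwa [← ofReal_norm, ENNReal.ofReal_le_iff_le_toReal h] at hx

theorem MeasureTheory.Lp.norm_top_le_of_ae_bound {α E : Type*} [MeasurableSpace α]
    [NormedAddCommGroup E] {μ : Measure α} {f : Lp E ⊤ μ} {C : ℝ} (hC : 0 ≤ C)
    (h : ∀ᵐ x ∂μ, ‖f x‖ ≤ C) : ‖f‖ ≤ C := by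
  rw [Lp.norm_def, eLpNorm_exponent_top]
  exact ENNReal.toReal_le_of_le_ofReal hC (eLpNormEssSup_le_of_ae_bound h)

namespace Supremal

open scoped Convolution

/-! ### The chain rule for weak derivatives -/

/-- `a` is the weak derivative of `z` on `Ω` in the direction `v`. The integrals extend over the
whole space, where the test functions vanish off `Ω`. -/
def IsWeakDeriv {N : ℕ} (Ω : Set (Euc N)) (v : Euc N) (z a : Euc N → ℝ) : Prop :=
  ∀ φ : Euc N → ℝ, ContDiff ℝ (⊤ : ℕ∞) φ → HasCompactSupport φ → tsupport φ ⊆ Ω →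
    ∫ x, z x * fderiv ℝ φ x v = - ∫ x, a x * φ x

variable {N : ℕ} {Ω : Set (Euc N)}

/-- At points of `Ω` farther from the boundary than the mollification radius, mollification
commutes with the weak derivative: the translated mollifier is an admissible test function. -/
theorem IsWeakDeriv.fderiv_convolution {v : Euc N} {z a : Euc N → ℝ} (h : IsWeakDeriv Ω v z a)
    (hz : LocallyIntegrable z volume) (ψ : ContDiffBump (0 : Euc N)) {x : Euc N}
    (hx : Metric.closedBall x ψ.rOut ⊆ Ω) :
    fderiv ℝ (ψ.normed volume ⋆[ContinuousLinearMap.lsmul ℝ ℝ, volume] z) x v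
      = (ψ.normed volume ⋆[ContinuousLinearMap.lsmul ℝ ℝ, volume] a) x := by
  have hψ : ContDiff ℝ (⊤ : ℕ∞) (ψ.normed volume) := ψ.contDiff_normed
  have hψc : HasCompactSupport (ψ.normed volume) := ψ.hasCompactSupport_normed
  have hψ1 : ContDiff ℝ 1 (ψ.normed volume) := ψ.contDiff_normed (n := 1)
  rw [(hψc.hasFDerivAt_convolution_left (ContinuousLinearMap.lsmul ℝ ℝ) hψ1 hz x).fderiv]
  have hint : ConvolutionExistsAt (fderiv ℝ (ψ.normed volume)) z x
      ((ContinuousLinearMap.lsmul ℝ ℝ : ℝ →L[ℝ] ℝ →L[ℝ] ℝ).precompL (Euc N)) volume :=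
    (hψc.fderiv ℝ).convolutionExists_left _ (hψ.continuous_fderiv (by simp)) hz x
  rw [convolution_def, ContinuousLinearMap.integral_apply hint]
  simp only [ContinuousLinearMap.precompL_apply, ContinuousLinearMap.lsmul_apply, convolution_def,
    smul_eq_mul]
  set η : Euc N → ℝ := fun y => ψ.normed volume (x - y) with hη
  have hηd : ContDiff ℝ (⊤ : ℕ∞) η := hψ.comp (contDiff_const.sub contDiff_id)
  have hηs : tsupport η ⊆ Metric.closedBall x ψ.rOut := by
    refine closure_minimal ?_ Metric.isClosed_closedBall
    intro y hy
    have : x - y ∈ Function.support (ψ.normed volume) := hy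
    rw [ψ.support_normed_eq] at this
    simpa [dist_eq_norm, norm_sub_rev] using (le_of_lt (by simpa using this) : ‖x - y‖ ≤ ψ.rOut)
  have hηc : HasCompactSupport η :=
    (isCompact_closedBall x ψ.rOut).of_isClosed_subset (isClosed_tsupport η) hηs
  have key := h η hηd hηc (hηs.trans hx)
  have hd : ∀ y, fderiv ℝ η y v = - fderiv ℝ (ψ.normed volume) (x - y) v := by
    intro y
    have h1 : HasFDerivAt η ((fderiv ℝ (ψ.normed volume) (x - y)).comp
        (-ContinuousLinearMap.id ℝ (Euc N))) y :=
      ((hψ.differentiable (by simp)).differentiableAt.hasFDerivAt).comp y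
        ((hasFDerivAt_id y).const_sub x)
    rw [h1.fderiv]; simp
  simp only [hd, mul_neg, integral_neg, neg_inj] at key
  rw [← integral_sub_left_eq_self (fun t => fderiv ℝ (ψ.normed volume) t v * z (x - t)) volume x,
    ← integral_sub_left_eq_self (fun t => ψ.normed volume t * a (x - t)) volume x]
  simpa [hη, mul_comm] using key

theorem norm_convolution_normed_le {z : Euc N → ℝ} {M : ℝ} (hM : ∀ᵐ x, ‖z x‖ ≤ M)
    (ψ : ContDiffBump (0 : Euc N)) (x : Euc N) :
    ‖(ψ.normed volume ⋆[ContinuousLinearMap.lsmul ℝ ℝ, volume] z) x‖ ≤ M := by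
  rw [convolution_def]
  have h1 : ∀ᵐ t, ‖z (x - t)‖ ≤ M :=
    (quasiMeasurePreserving_sub_left volume x).ae hM
  refine (norm_integral_le_of_norm_le (ψ.integrable_normed.mul_const M) ?_).trans ?_
  · filter_upwards [h1] with t ht
    simp only [ContinuousLinearMap.lsmul_apply, smul_eq_mul, norm_mul,
      Real.norm_of_nonneg (ψ.nonneg_normed t)]
    exact mul_le_mul_of_nonneg_left ht (ψ.nonneg_normed t)
  · rw [integral_mul_const, ψ.integral_normed, one_mul]

/-- Chain rule for a `C¹` outer function `K` with derivative `p`. It is the limit of the classical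
chain rule for the mollifications of `z`. -/
theorem IsWeakDeriv.comp_of_hasDerivAt (hΩ : IsOpen Ω) {v : Euc N} {z a : Euc N → ℝ}
    (h : IsWeakDeriv Ω v z a) (hz : MemLp z ⊤) (ha : MemLp a ⊤)
    {K p : ℝ → ℝ} (hp : Continuous p) (hK : ∀ s, HasDerivAt K (p s) s) :
    IsWeakDeriv Ω v (fun x => K (z x)) (fun x => p (z x) * a x) := by
  intro φ hφ hc hs
  have hd := continuous_fderiv_apply_of_smooth hφ v
  have hdc := hasCompactSupport_fderiv_apply hc v
  have hKc : Continuous K := continuous_iff_continuousAt.2 fun s => (hK s).continuousAt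
  have hzl : LocallyIntegrable z volume := hz.locallyIntegrable le_top
  have hal : LocallyIntegrable a volume := ha.locallyIntegrable le_top
  obtain ⟨M, hM⟩ : ∃ M : ℝ, ∀ᵐ x, ‖z x‖ ≤ M := ⟨_, hz.ae_norm_le⟩
  obtain ⟨B, hB⟩ : ∃ B : ℝ, ∀ᵐ x, ‖a x‖ ≤ B := ⟨_, ha.ae_norm_le⟩
  obtain ⟨CK, hCK⟩ := (isCompact_Icc (a := -M) (b := M)).exists_bound_of_continuousOn
    hKc.continuousOn
  obtain ⟨Cp, hCp⟩ := (isCompact_Icc (a := -M) (b := M)).exists_bound_of_continuousOn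
    hp.continuousOn
  obtain ⟨δ, hδ, hδΩ⟩ := hc.isCompact.exists_cthickening_subset_open hΩ hs
  -- Mollifiers of radius at most `δ`, so that near `tsupport φ` only values in `Ω` are averaged;
  -- the ratio of the radii stays fixed, as the Lebesgue differentiation theorem requires.
  have hr : ∀ n : ℕ, 0 < δ / (n + 1) := fun n => by positivity
  let ψ : ℕ → ContDiffBump (0 : Euc N) := fun n =>
    ⟨δ / (n + 1) / 2, δ / (n + 1), half_pos (hr n), half_lt_self (hr n)⟩
  have hψ0 : Tendsto (fun n => (ψ n).rOut) atTop (𝓝 0) :=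
    tendsto_const_div_atTop_nhds_zero_nat δ |>.comp (tendsto_add_atTop_nat 1) |>.congr
      fun n => by simp [ψ]
  have hψK : ∀ᶠ n in atTop, (ψ n).rOut ≤ 2 * (ψ n).rIn :=
    Eventually.of_forall fun n => by simp only [ψ]; linarith
  have hψδ : ∀ n, (ψ n).rOut ≤ δ := fun n => div_le_self hδ.le (by simp)
  let zn : ℕ → Euc N → ℝ := fun n =>
    ((ψ n).normed volume ⋆[ContinuousLinearMap.lsmul ℝ ℝ, volume] z)
  let an : ℕ → Euc N → ℝ := fun n =>
    ((ψ n).normed volume ⋆[ContinuousLinearMap.lsmul ℝ ℝ, volume] a)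
  have hzn : ∀ n, ContDiff ℝ 1 (zn n) := fun n =>
    (ψ n).hasCompactSupport_normed.contDiff_convolution_left _ (n := 1) (ψ n).contDiff_normed hzl
  have han : ∀ n, Continuous (an n) := fun n =>
    ((ψ n).hasCompactSupport_normed.contDiff_convolution_left _ (n := 0)
      (ψ n).contDiff_normed hal).continuous
  have hzlim := ContDiffBump.ae_convolution_tendsto_right_of_locallyIntegrable
    (μ := (volume : Measure (Euc N))) hψ0 hψK hzl
  have halim := ContDiffBump.ae_convolution_tendsto_right_of_locallyIntegrable
    (μ := (volume : Measure (Euc N))) hψ0 hψK hal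
  have hznM : ∀ n x, zn n x ∈ Set.Icc (-M) M := fun n x =>
    abs_le.1 (norm_convolution_normed_le hM (ψ n) x)
  have hderiv : ∀ n x, HasFDerivAt (fun y => K (zn n y)) (p (zn n x) • fderiv ℝ (zn n) x) x :=
    fun n x => (hK _).comp_hasFDerivAt x
      ((hzn n).differentiable (by simp)).differentiableAt.hasFDerivAt
  have hcn : ∀ n, Continuous fun x => p (zn n x) * fderiv ℝ (zn n) x v := fun n =>
    (hp.comp (hzn n).continuous).mul
      (((hzn n).continuous_fderiv (by simp)).clm_apply continuous_const)
  have heq : ∀ n, ∫ x, K (zn n x) * fderiv ℝ φ x v = - ∫ x, p (zn n x) * an n x * φ x := by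
    intro n
    have hKn : Continuous fun x => K (zn n x) := hKc.comp (hzn n).continuous
    have e := integral_mul_fderiv_eq_neg_fderiv_mul_of_integrable
      (μ := (volume : Measure (Euc N))) (f := fun y => K (zn n y)) (g := φ) (v := v)
      (by
        simp only [(hderiv n _).fderiv, _root_.smul_apply, smul_eq_mul]
        exact ((hcn n).mul hφ.continuous).integrable_of_hasCompactSupport hc.mul_left)
      ((hKn.mul hd).integrable_of_hasCompactSupport hdc.mul_left)
      ((hKn.mul hφ.continuous).integrable_of_hasCompactSupport hc.mul_left)
      (fun x _ => (hderiv n x).differentiableAt)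
      (fun x _ => (hφ.differentiable (by simp)).differentiableAt)
    rw [e]
    congr 1
    refine integral_congr_ae (Eventually.of_forall fun x => ?_)
    simp only [(hderiv n x).fderiv, _root_.smul_apply, smul_eq_mul]
    by_cases hx : x ∈ tsupport φ
    · rw [h.fderiv_convolution hzl (ψ n)]
      exact (Metric.closedBall_subset_closedBall (hψδ n)).trans
        ((Metric.closedBall_subset_cthickening hx δ).trans hδΩ)
    · rw [image_eq_zero_of_notMem_tsupport hx, mul_zero, mul_zero]
  have hlim1 : Tendsto (fun n => ∫ x, K (zn n x) * fderiv ℝ φ x v) atTop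
      (𝓝 (∫ x, K (z x) * fderiv ℝ φ x v)) := by
    refine tendsto_integral_of_dominated_convergence (fun x => CK * ‖fderiv ℝ φ x v‖)
      (fun n => ((hKc.comp (hzn n).continuous).mul hd).aestronglyMeasurable)
      ((hd.integrable_of_hasCompactSupport hdc).norm.const_mul _) (fun n => ?_) ?_
    · refine Eventually.of_forall fun x => ?_
      rw [norm_mul]
      exact mul_le_mul_of_nonneg_right (hCK _ (hznM n x)) (norm_nonneg _)
    · filter_upwards [hzlim] with x hx
      exact ((hKc.tendsto _).comp hx).mul_const _
  have hlim2 : Tendsto (fun n => ∫ x, p (zn n x) * an n x * φ x) atTop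
      (𝓝 (∫ x, p (z x) * a x * φ x)) := by
    refine tendsto_integral_of_dominated_convergence (fun x => Cp * B * ‖φ x‖)
      (fun n => (((hp.comp (hzn n).continuous).mul (han n)).mul
        hφ.continuous).aestronglyMeasurable)
      ((hφ.continuous.integrable_of_hasCompactSupport hc).norm.const_mul _) (fun n => ?_) ?_
    · refine Eventually.of_forall fun x => ?_
      rw [norm_mul, norm_mul]
      have h1 := hCp _ (hznM n x)
      have h2 := norm_convolution_normed_le hB (ψ n) x
      gcongr
      exact (norm_nonneg _).trans h1
    · filter_upwards [hzlim, halim] with x hx hx'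
      exact (((hp.tendsto _).comp hx).mul hx').mul_const _
  exact tendsto_nhds_unique (hlim1.congr heq) hlim2.neg

/-- Chain rule for the primitive of the indicator function of a closed set `E`, the bounded
pointwise limit of continuous functions. -/
theorem IsWeakDeriv.comp_integral_indicator (hΩ : IsOpen Ω) {v : Euc N} {z a : Euc N → ℝ}
    (h : IsWeakDeriv Ω v z a) (hz : MemLp z ⊤) (ha : MemLp a ⊤) {E : Set ℝ} (hE : IsClosed E) :
    IsWeakDeriv Ω v (fun x => ∫ t in (0 : ℝ)..z x, E.indicator 1 t)
      (fun x => E.indicator 1 (z x) * a x) := by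
  intro φ hφ hc hs
  have hd := continuous_fderiv_apply_of_smooth hφ v
  have hdc := hasCompactSupport_fderiv_apply hc v
  obtain ⟨M, hM⟩ : ∃ M : ℝ, ∀ᵐ x, ‖z x‖ ≤ M := ⟨_, hz.ae_norm_le⟩
  obtain ⟨B, hB⟩ : ∃ B : ℝ, ∀ᵐ x, ‖a x‖ ≤ B := ⟨_, ha.ae_norm_le⟩
  have hδ : ∀ n : ℕ, (0 : ℝ) < 1 / ((n : ℝ) + 1) := fun n => Nat.one_div_pos_of_nat
  let p : ℕ → ℝ → ℝ := fun n s => thickenedIndicator (hδ n) E s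
  have hpc : ∀ n, Continuous (p n) := fun n =>
    NNReal.continuous_coe.comp (thickenedIndicator (hδ n) E).continuous
  have hp1 : ∀ n s, ‖p n s‖ ≤ 1 := fun n s => by
    rw [Real.norm_of_nonneg (NNReal.coe_nonneg _)]
    exact_mod_cast thickenedIndicator_le_one (hδ n) E s
  have hplim : ∀ s, Tendsto (fun n => p n s) atTop (𝓝 (E.indicator 1 s)) := fun s => by
    have h1 := (tendsto_pi_nhds.1 (thickenedIndicator_tendsto_indicator_closure hδ
      tendsto_one_div_add_atTop_nhds_zero_nat E)) s
    have h2 := (NNReal.continuous_coe.tendsto _).comp h1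
    rw [hE.closure_eq] at h2
    have h3 : ((E.indicator (fun _ => 1) s : NNReal) : ℝ) = E.indicator 1 s := by
      by_cases hs : s ∈ E <;> simp [hs]
    rwa [h3] at h2
  have hKlim : ∀ s, Tendsto (fun n => ∫ t in (0 : ℝ)..s, p n t) atTop
      (𝓝 (∫ t in (0 : ℝ)..s, E.indicator 1 t)) := fun s =>
    intervalIntegral.tendsto_integral_filter_of_dominated_convergence (fun _ => 1)
      (Eventually.of_forall fun n => (hpc n).aestronglyMeasurable)
      (Eventually.of_forall fun n => Eventually.of_forall fun t _ => hp1 n t)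
      intervalIntegrable_const (Eventually.of_forall fun t _ => hplim t)
  have hK1 : ∀ n s, ‖∫ t in (0 : ℝ)..s, p n t‖ ≤ |s| := fun n s => by
    simpa using intervalIntegral.norm_integral_le_of_norm_le_const (a := 0) (b := s)
      (fun t _ => hp1 n t)
  have hKd : ∀ n s, HasDerivAt (fun s => ∫ t in (0 : ℝ)..s, p n t) (p n s) s := fun n s =>
    intervalIntegral.integral_hasDerivAt_right ((hpc n).intervalIntegrable _ _)
      ((hpc n).stronglyMeasurableAtFilter _ _) (hpc n).continuousAt
  have hKc : ∀ n, Continuous (fun s => ∫ t in (0 : ℝ)..s, p n t) := fun n =>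
    continuous_iff_continuousAt.2 fun s => (hKd n s).continuousAt
  have heq := fun n => h.comp_of_hasDerivAt hΩ hz ha (hpc n) (hKd n) φ hφ hc hs
  have hlim1 : Tendsto (fun n => ∫ x, (∫ t in (0 : ℝ)..z x, p n t) * fderiv ℝ φ x v) atTop
      (𝓝 (∫ x, (∫ t in (0 : ℝ)..z x, E.indicator 1 t) * fderiv ℝ φ x v)) := by
    refine tendsto_integral_of_dominated_convergence (fun x => M * ‖fderiv ℝ φ x v‖)
      (fun n => ((hKc n).comp_aestronglyMeasurable hz.1).mul hd.aestronglyMeasurable)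
      ((hd.integrable_of_hasCompactSupport hdc).norm.const_mul _) (fun n => ?_) ?_
    · filter_upwards [hM] with x hx
      rw [norm_mul]
      exact mul_le_mul_of_nonneg_right ((hK1 n _).trans hx) (norm_nonneg _)
    · exact Eventually.of_forall fun x => (hKlim (z x)).mul_const _
  have hlim2 : Tendsto (fun n => ∫ x, p n (z x) * a x * φ x) atTop
      (𝓝 (∫ x, E.indicator 1 (z x) * a x * φ x)) := by
    refine tendsto_integral_of_dominated_convergence (fun x => 1 * B * ‖φ x‖)
      (fun n => (((hpc n).comp_aestronglyMeasurable hz.1).mul ha.1).mul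
        hφ.continuous.aestronglyMeasurable)
      ((hφ.continuous.integrable_of_hasCompactSupport hc).norm.const_mul _) (fun n => ?_) ?_
    · filter_upwards [hB] with x hx
      rw [norm_mul, norm_mul]
      have := hp1 n (z x)
      gcongr
    · exact Eventually.of_forall fun x => ((hplim (z x)).mul_const _).mul_const _
  exact tendsto_nhds_unique (hlim1.congr heq) hlim2.neg

/-! ### Superposition in the Sobolev space -/

theorem isWeakGradient_iff (hΩ : MeasurableSet Ω) {u : Euc N → ℝ} {g : Euc N → Euc N} :
    IsWeakGradient Ω u g ↔ ∀ v, IsWeakDeriv Ω v (Ω.indicator u)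
      (Ω.indicator fun x => (inner ℝ (g x) v : ℝ)) := by
  have h : ∀ w ψ : Euc N → ℝ, ∫ x in Ω, w x * ψ x = ∫ x, Ω.indicator w x * ψ x := by
    intro w ψ
    rw [← integral_indicator hΩ]
    simp only [Set.indicator_mul_left]
  simp only [IsWeakGradient, IsWeakDeriv, h]
  exact ⟨fun H v φ h1 h2 h3 => H φ h1 h2 h3 v, fun H φ h1 h2 h3 v => H v φ h1 h2 h3⟩

theorem IsWeakGradient.congr_ae {u u' : Euc N → ℝ} {g g' : Euc N → Euc N}
    (h : IsWeakGradient Ω u g) (hu : u' =ᵐ[volume.restrict Ω] u)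
    (hg : g' =ᵐ[volume.restrict Ω] g) : IsWeakGradient Ω u' g' := by
  intro φ h1 h2 h3 v
  rw [integral_congr_ae (g := fun x => u x * fderiv ℝ φ x v), h φ h1 h2 h3 v,
    integral_congr_ae (f := fun x => (inner ℝ (g x) v : ℝ) * φ x)]
  · filter_upwards [hg] with x hx
    rw [hx]
  · filter_upwards [hu] with x hx
    rw [hx]

theorem IsWeakGradient.comp_integral_indicator (hΩ : IsOpen Ω) {u : Euc N → ℝ}
    {g : Euc N → Euc N} (h : IsWeakGradient Ω u g) (hu : MemLp u ⊤ (volume.restrict Ω))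
    (hg : MemLp g ⊤ (volume.restrict Ω)) {E : Set ℝ} (hE : IsClosed E) :
    IsWeakGradient Ω (fun x => ∫ t in (0 : ℝ)..u x, E.indicator 1 t)
      (fun x => E.indicator (1 : ℝ → ℝ) (u x) • g x) := by
  rw [isWeakGradient_iff hΩ.measurableSet] at h ⊢
  intro v
  convert (h v).comp_integral_indicator hΩ ((memLp_indicator_iff_restrict hΩ.measurableSet).2 hu)
    ((memLp_indicator_iff_restrict hΩ.measurableSet).2 (hg.inner_const v)) hE using 1
  · ext x
    by_cases hx : x ∈ Ω <;> simp [hx]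
  · ext x
    by_cases hx : x ∈ Ω <;> simp [hx, inner_smul_left]

theorem intervalIntegrable_indicator_one {E : Set ℝ} (hE : MeasurableSet E) (a b : ℝ) :
    IntervalIntegrable (E.indicator (1 : ℝ → ℝ)) volume a b :=
  (intervalIntegrable_const (c := (1 : ℝ))).mono_fun
    (measurable_one.indicator hE).aestronglyMeasurable
    (Eventually.of_forall fun t => by by_cases ht : t ∈ E <;> simp [ht])

theorem abs_integral_indicator_sub_le (E : Set ℝ) (hE : MeasurableSet E) (s t : ℝ) :
    |(∫ r in (0 : ℝ)..s, E.indicator (1 : ℝ → ℝ) r) - ∫ r in (0 : ℝ)..t, E.indicator 1 r|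
      ≤ |s - t| := by
  rw [intervalIntegral.integral_interval_sub_left (intervalIntegrable_indicator_one hE _ _)
    (intervalIntegrable_indicator_one hE _ _)]
  simpa using intervalIntegral.norm_integral_le_of_norm_le_const (a := t) (b := s) (C := 1)
    (f := E.indicator (1 : ℝ → ℝ)) (fun r _ => by by_cases hr : r ∈ E <;> simp [hr])

/-- Superposition in `W^{1,∞}(Ω)` with the primitive of the indicator function of a closed set. -/
theorem W1infty.exists_comp_integral_indicator (hΩ : IsOpen Ω) (z : W1infty Ω) {E : Set ℝ}
    (hE : IsClosed E) : ∃ y : W1infty Ω,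
      fn y =ᵐ[volume.restrict Ω] (fun x => ∫ t in (0 : ℝ)..fn z x, E.indicator 1 t) ∧
      grad y =ᵐ[volume.restrict Ω] fun x => E.indicator (1 : ℝ → ℝ) (fn z x) • grad z x := by
  have hlip : LipschitzWith 1 fun s => ∫ t in (0 : ℝ)..s, E.indicator (1 : ℝ → ℝ) t :=
    LipschitzWith.of_dist_le_mul fun s t => by
      simpa [Real.dist_eq] using abs_integral_indicator_sub_le E hE.measurableSet s t
  have hu : MemLp (fun x => ∫ t in (0 : ℝ)..fn z x, E.indicator (1 : ℝ → ℝ) t) ⊤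
      (volume.restrict Ω) :=
    (Lp.memLp (fn z)).of_le (hlip.continuous.comp_aestronglyMeasurable (Lp.memLp (fn z)).1)
      (Eventually.of_forall fun x => by
        simpa using abs_integral_indicator_sub_le E hE.measurableSet (fn z x) 0)
  have hg : MemLp (fun x => E.indicator (1 : ℝ → ℝ) (fn z x) • grad z x) ⊤
      (volume.restrict Ω) := by
    refine (Lp.memLp (grad z)).of_le ?_ (Eventually.of_forall fun x => ?_)
    · have hm : Measurable (E.indicator (1 : ℝ → ℝ)) := measurable_one.indicator hE.measurableSet
      exact (hm.comp_aemeasurable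
        (Lp.memLp (fn z)).1.aemeasurable).aestronglyMeasurable.smul (Lp.memLp (grad z)).1
    · by_cases hx : fn z x ∈ E <;> simp [hx]
  have hz : IsWeakGradient Ω (fn z) (grad z) := z.2
  exact ⟨⟨(hu.toLp _, hg.toLp _), (hz.comp_integral_indicator hΩ (Lp.memLp _) (Lp.memLp _)
    hE).congr_ae hu.coeFn_toLp hg.coeFn_toLp⟩, hu.coeFn_toLp, hg.coeFn_toLp⟩

/-! ### Periodic sets of given density -/

/-- There is a closed `1`-periodic set of density `θ`, so that the primitive of its indicator
function stays at bounded distance from `s ↦ θ s`: the set of the points at distance at most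
`θ / 2` from the integers. -/
theorem exists_isClosed_abs_integral_indicator_sub_le {θ : ℝ} (h0 : 0 ≤ θ) (h1 : θ ≤ 1) :
    ∃ E : Set ℝ, IsClosed E ∧
      ∀ s, |(∫ t in (0 : ℝ)..s, E.indicator (1 : ℝ → ℝ) t) - θ * s| ≤ 2 := by
  let B : Set UnitAddCircle := Metric.closedBall 0 (θ / 2)
  let E : Set ℝ := (fun s : ℝ => (s : UnitAddCircle)) ⁻¹' B
  have hE : IsClosed E := Metric.isClosed_closedBall.preimage (AddCircle.continuous_mk' 1)
  refine ⟨E, hE, fun s => ?_⟩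
  have hper : Function.Periodic (E.indicator (1 : ℝ → ℝ)) 1 := by
    intro t
    have ht : t + 1 ∈ E ↔ t ∈ E := by
      simp only [E, Set.mem_preimage, AddCircle.coe_add_period]
    by_cases ht' : t ∈ E <;> simp [ht, ht']
  have hmean : ∫ t in (0 : ℝ)..1, E.indicator (1 : ℝ → ℝ) t = θ := by
    have h2 := UnitAddCircle.intervalIntegral_preimage 0 (B.indicator (1 : UnitAddCircle → ℝ))
    rw [zero_add, integral_indicator_one Metric.isClosed_closedBall.measurableSet] at h2
    have h3 : (volume B).toReal = θ := by
      rw [AddCircle.volume_closedBall, ENNReal.toReal_ofReal (by positivity)]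
      rw [mul_div_cancel₀ _ two_ne_zero, min_eq_right h1]
    rw [← h3]
    exact h2
  have hfloor : ∫ t in (0 : ℝ)..(⌊s⌋ : ℝ), E.indicator (1 : ℝ → ℝ) t = ⌊s⌋ * θ := by
    have h2 := hper.intervalIntegral_add_zsmul_eq ⌊s⌋ 0 
      (fun a b => intervalIntegrable_indicator_one hE.measurableSet a b)
    simpa [hmean] using h2
  -- Whole periods contribute exactly `θ` each, so that only the fractional part of `s` matters.
  have hfract := abs_integral_indicator_sub_le E hE.measurableSet s ⌊s⌋
  rw [hfloor] at hfract
  have hs0 := Int.fract_nonneg s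
  have hs1 := (Int.fract_lt_one s).le
  rw [Int.self_sub_floor, abs_of_nonneg hs0, abs_le] at hfract
  have hsf := Int.floor_add_fract s
  have hmul : θ * s = ⌊s⌋ * θ + θ * Int.fract s := by
    rw [mul_comm _ θ, ← mul_add, hsf]
  have h4 : 0 ≤ θ * Int.fract s := mul_nonneg h0 hs0
  have h5 : θ * Int.fract s ≤ 1 := mul_le_one₀ h1 hs0 hs1
  rw [abs_le, hmul]
  constructor <;> linarith [hfract.1, hfract.2]

/-! ### Weak* convergence -/

/-- On a bounded open set the test functions are dense in `L^1`. -/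
theorem exists_testFunction_integral_norm_sub_lt (hΩ : IsOpen Ω) (hb : Bornology.IsBounded Ω)
    {g : Euc N → ℝ} (hg : Integrable g (volume.restrict Ω)) {ε : ℝ} (hε : 0 < ε) :
    ∃ φ : Euc N → ℝ, ContDiff ℝ (⊤ : ℕ∞) φ ∧ HasCompactSupport φ ∧ tsupport φ ⊆ Ω ∧
      ∫ x in Ω, ‖g x - φ x‖ ≤ ε := by
  have : IsFiniteMeasure (volume.restrict Ω) := ⟨by simpa using hb.measure_lt_top⟩
  obtain ⟨φ, hφc, hφ, hφε⟩ := (memLp_one_iff_integrable.2 hg).exist_eLpNorm_sub_le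
    ENNReal.one_ne_top le_rfl (half_pos hε)
  obtain ⟨C, hC⟩ := hφ.continuous.bounded_above_of_compact_support hφc
  have hC0 : 0 ≤ C := (norm_nonneg _).trans (hC 0)
  -- The approximant is cut off by a function that equals `1` up to a set of small measure.
  obtain ⟨K, hKΩ, hK, hKm⟩ : ∃ K ⊆ Ω, IsCompact K ∧
      volume.real (Ω \ K) ≤ ε / 2 / (C + 1) := by
    have hε' : 0 < ε / 2 / (C + 1) := by positivity
    obtain ⟨K, hKΩ, hK, hKm⟩ := hΩ.measurableSet.exists_isCompact_sdiff_lt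
      (hb.measure_lt_top (μ := volume)).ne (ENNReal.ofReal_pos.2 hε').ne'
    exact ⟨K, hKΩ, hK, ENNReal.toReal_le_of_le_ofReal hε'.le hKm.le⟩
  obtain ⟨L, hL, hKL, hLΩ⟩ := exists_compact_between hK hΩ hKΩ
  obtain ⟨χ, hχ1, hχ0, hχ⟩ := exists_contMDiffMap_one_nhds_of_subset_interior (n := (⊤ : ℕ∞))
    (modelWithCornersSelf ℝ (Euc N)) hK.isClosed hKL
  have hχs : tsupport χ ⊆ L :=
    closure_minimal (fun x hx => by by_contra h; exact hx (hχ0 x h)) hL.isClosed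
  have hχd : ContDiff ℝ (⊤ : ℕ∞) χ := χ.contMDiff.contDiff
  have hi : Integrable φ (volume.restrict Ω) :=
    (hφ.continuous.integrable_of_hasCompactSupport hφc).restrict
  have hχφ : Integrable (fun x => χ x * φ x) (volume.restrict Ω) :=
    ((hχd.continuous.mul hφ.continuous).integrable_of_hasCompactSupport hφc.mul_left).restrict
  refine ⟨fun x => χ x * φ x, hχd.mul hφ, hφc.mul_left,
    ((tsupport_mul_subset_left).trans hχs).trans hLΩ, ?_⟩
  have h1 : ∫ x in Ω, ‖g x - φ x‖ ≤ ε / 2 := by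
    rw [integral_norm_eq_lintegral_enorm (f := fun x => g x - φ x) (hg.sub hi).1]
    refine ENNReal.toReal_le_of_le_ofReal (half_pos hε).le ?_
    simpa [eLpNorm_one_eq_lintegral_enorm] using hφε
  have h2 : ∫ x in Ω, ‖φ x - χ x * φ x‖ ≤ ε / 2 := by
    have h3 : ∀ x ∈ Ω, ‖φ x - χ x * φ x‖ ≤ (Ω \ K).indicator (fun _ => C) x := by
      intro x hx
      by_cases hxK : x ∈ K
      · simp [hχ1.self_of_nhdsSet x hxK, hxK]
      · rw [Set.indicator_of_mem (show x ∈ Ω \ K from ⟨hx, hxK⟩), ← one_sub_mul, norm_mul]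
        have h4 : ‖1 - χ x‖ ≤ 1 := by
          rw [Real.norm_eq_abs, abs_le]
          constructor <;> linarith [(hχ x).1, (hχ x).2]
        simpa using mul_le_mul h4 (hC x) (norm_nonneg _) zero_le_one
    have hm : MeasurableSet (Ω \ K) := hΩ.measurableSet.diff hK.measurableSet
    refine (setIntegral_mono_on (hi.sub hχφ).norm ((integrable_const C).indicator hm)
      hΩ.measurableSet h3).trans ?_
    rw [integral_indicator hm, Measure.restrict_restrict hm,
      Set.inter_eq_left.2 Set.sdiff_subset, setIntegral_const, smul_eq_mul]
    calc volume.real (Ω \ K) * C ≤ ε / 2 / (C + 1) * (C + 1) := by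
          gcongr; linarith
      _ = ε / 2 := by field_simp
  calc ∫ x in Ω, ‖g x - χ x * φ x‖
      ≤ ∫ x in Ω, (‖g x - φ x‖ + ‖φ x - χ x * φ x‖) :=
        integral_mono (hg.sub hχφ).norm ((hg.sub hi).norm.add (hi.sub hχφ).norm)
          fun x => norm_sub_le_norm_sub_add_norm_sub _ _ _
    _ = (∫ x in Ω, ‖g x - φ x‖) + ∫ x in Ω, ‖φ x - χ x * φ x‖ :=
        integral_add (hg.sub hi).norm (hi.sub hχφ).norm
    _ ≤ ε := by linarith

/-- For an essentially bounded sequence, convergence of the pairings with test functions extends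
to all integrable functions, by density. -/
theorem tendsto_setIntegral_mul_of_testFunction (hΩ : IsOpen Ω) (hb : Bornology.IsBounded Ω)
    {h : ℕ → Euc N → ℝ} {C : ℝ} (hm : ∀ n, AEStronglyMeasurable (h n) (volume.restrict Ω))
    (hC : ∀ n, ∀ᵐ x ∂volume.restrict Ω, ‖h n x‖ ≤ C)
    (hlim : ∀ φ : Euc N → ℝ, ContDiff ℝ (⊤ : ℕ∞) φ → HasCompactSupport φ → tsupport φ ⊆ Ω →
      Tendsto (fun n => ∫ x in Ω, h n x * φ x) atTop (𝓝 0))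
    {g : Euc N → ℝ} (hg : Integrable g (volume.restrict Ω)) :
    Tendsto (fun n => ∫ x in Ω, h n x * g x) atTop (𝓝 0) := by
  have hi : ∀ {w : Euc N → ℝ}, Integrable w (volume.restrict Ω) → ∀ n,
      Integrable (fun x => h n x * w x) (volume.restrict Ω) := fun hw n =>
    hw.bdd_mul (hm n) (hC n)
  rw [Metric.tendsto_atTop]
  intro ε hε
  have hC1 : 0 < |C| + 1 := by positivity
  obtain ⟨φ, hφ, hφc, hφΩ, hφg⟩ := exists_testFunction_integral_norm_sub_lt hΩ hb hg
    (show 0 < ε / 2 / (|C| + 1) by positivity)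
  have hφi : Integrable φ (volume.restrict Ω) :=
    (hφ.continuous.integrable_of_hasCompactSupport hφc).restrict
  obtain ⟨n₀, hn₀⟩ := Metric.tendsto_atTop.1 (hlim φ hφ hφc hφΩ) (ε / 2) (half_pos hε)
  refine ⟨n₀, fun n hn => ?_⟩
  have h1 := hn₀ n hn
  rw [dist_zero_right] at h1 ⊢
  have h2 : ∫ x in Ω, h n x * g x
      = (∫ x in Ω, h n x * φ x) + ∫ x in Ω, h n x * (g x - φ x) := by
    have h4 : Integrable (fun x => h n x * (g x - φ x)) (volume.restrict Ω) :=
      hi (hg.sub hφi) n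
    rw [← integral_add (hi hφi n) h4]
    simp only [← mul_add, add_sub_cancel]
  have h3 : ‖∫ x in Ω, h n x * (g x - φ x)‖ ≤ ε / 2 := by
    refine (norm_integral_le_of_norm_le ((hg.sub hφi).norm.const_mul (|C| + 1)) ?_).trans ?_
    · filter_upwards [hC n] with x hx
      rw [norm_mul]
      refine mul_le_mul_of_nonneg_right (hx.trans ?_) (norm_nonneg _)
      linarith [le_abs_self C]
    · rw [integral_const_mul]
      calc (|C| + 1) * ∫ x in Ω, ‖g x - φ x‖ ≤ (|C| + 1) * (ε / 2 / (|C| + 1)) := by gcongr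
        _ = ε / 2 := by field_simp
  rw [h2]
  exact (norm_add_le _ _).trans_lt (by linarith)

theorem integrable_inner_Linfty {G : Type} [NormedAddCommGroup G] [InnerProductSpace ℝ G]
    (g : Lp G 1 (volume.restrict Ω)) (u : Linfty Ω G) :
    Integrable (fun x => (inner ℝ (g x) (u x) : ℝ)) (volume.restrict Ω) := by
  refine ((L1.integrable_coeFn g).norm.mul_const ‖u‖).mono'
    ((Lp.memLp g).1.inner (Lp.memLp u).1) ?_
  filter_upwards [(Lp.memLp u).ae_norm_le] with x hx
  rw [← Lp.norm_def] at hx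
  exact (norm_inner_le_norm _ _).trans (mul_le_mul_of_nonneg_left hx (norm_nonneg _))

theorem setIntegral_inner_sub {G : Type} [NormedAddCommGroup G] [InnerProductSpace ℝ G]
    (g : Lp G 1 (volume.restrict Ω)) (u w : Linfty Ω G) :
    (∫ x in Ω, (inner ℝ (g x) (u x) : ℝ)) - ∫ x in Ω, (inner ℝ (g x) (w x) : ℝ)
      = ∫ x in Ω, (inner ℝ (g x) ((u - w) x) : ℝ) := by
  rw [← integral_sub (integrable_inner_Linfty g u) (integrable_inner_Linfty g w)]
  refine integral_congr_ae ?_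
  filter_upwards [Lp.coeFn_sub u w] with x hx
  rw [hx, Pi.sub_apply, inner_sub_right]

/-- A sequence in `W^{1,∞}(Ω)` that converges uniformly and has bounded gradients converges in
the weak* topology: against a test function, the gradient can be integrated by parts. -/
theorem tendsto_weakStarTopology (hΩ : IsOpen Ω) (hb : Bornology.IsBounded Ω)
    {x : ℕ → W1infty Ω} {y : W1infty Ω} {C : ℝ}
    (h1 : Tendsto (fun n => ‖fn (x n) - fn y‖) atTop (𝓝 0))
    (h2 : ∀ n, ‖grad (x n) - grad y‖ ≤ C) :
    Tendsto x atTop (@nhds _ (weakStarTopology Ω) y) := by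
  have : IsFiniteMeasure (volume.restrict Ω) := ⟨by simpa using hb.measure_lt_top⟩
  have hfn : ∀ w : Euc N → ℝ, Integrable w (volume.restrict Ω) →
      Tendsto (fun n => ∫ t in Ω, (fn (x n) - fn y) t * w t) atTop (𝓝 0) := by
    intro w hw
    refine squeeze_zero_norm (fun n => ?_) (by simpa using h1.mul_const (∫ t in Ω, ‖w t‖))
    rw [← integral_const_mul]
    refine norm_integral_le_of_norm_le (hw.norm.const_mul _) ?_
    filter_upwards [(Lp.memLp (fn (x n) - fn y)).ae_norm_le] with t ht
    rw [norm_mul]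
    exact mul_le_mul_of_nonneg_right ht (norm_nonneg _)
  have hgrad : ∀ (v : Euc N) (w : Euc N → ℝ), Integrable w (volume.restrict Ω) →
      Tendsto (fun n => ∫ t in Ω, (inner ℝ ((grad (x n) - grad y) t) v : ℝ) * w t)
        atTop (𝓝 0) := by
    intro v w hw
    refine tendsto_setIntegral_mul_of_testFunction hΩ hb (C := C * ‖v‖)
      (fun n => ((Lp.memLp (grad (x n) - grad y)).inner_const v).1) (fun n => ?_) ?_ hw
    · filter_upwards [(Lp.memLp (grad (x n) - grad y)).ae_norm_le] with t ht
      exact (norm_inner_le_norm _ _).trans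
        (mul_le_mul_of_nonneg_right (ht.trans (h2 n)) (norm_nonneg _))
    · intro φ hφ hc hs
      have e : ∀ n, ∫ t in Ω, (inner ℝ ((grad (x n) - grad y) t) v : ℝ) * φ t
          = - ∫ t in Ω, (fn (x n) - fn y) t * fderiv ℝ φ t v := fun n => by
        have := (x n - y).2 φ hφ hc hs v
        exact neg_eq_iff_eq_neg.1 this.symm
      simp only [e]
      rw [← neg_zero]
      exact (hfn _ (((continuous_fderiv_apply_of_smooth hφ v).integrable_of_hasCompactSupport
        (hasCompactSupport_fderiv_apply hc v)).restrict)).neg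
  rw [@nhds_inf _ (TopologicalSpace.induced fn (weakStarLinfty Ω ℝ))
      (TopologicalSpace.induced grad (weakStarLinfty Ω (Euc N))) y,
    tendsto_inf, @nhds_induced _ _ (weakStarLinfty Ω ℝ),
    @nhds_induced _ _ (weakStarLinfty Ω (Euc N)), tendsto_comap_iff, tendsto_comap_iff]
  simp only [nhds_iInf, nhds_induced, tendsto_iInf, tendsto_comap_iff]
  constructor
  · intro g
    rw [← tendsto_sub_nhds_zero_iff]
    refine (hfn g (L1.integrable_coeFn g)).congr fun n => ?_
    refine Eq.trans ?_ (setIntegral_inner_sub g (fn (x n)) (fn y)).symm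
    exact integral_congr_ae (Eventually.of_forall fun t => by simp)
  · intro g
    rw [← tendsto_sub_nhds_zero_iff]
    have hgi : ∀ i, Integrable (fun t => g t i) (volume.restrict Ω) := fun i =>
      (EuclideanSpace.proj (𝕜 := ℝ) i).integrable_comp (L1.integrable_coeFn g)
    have hsum := tendsto_finsetSum Finset.univ fun i (_ : i ∈ Finset.univ) =>
      hgrad (EuclideanSpace.single i (1 : ℝ)) _ (hgi i)
    rw [Finset.sum_const_zero] at hsum
    refine hsum.congr fun n => ?_
    refine Eq.trans ?_ (setIntegral_inner_sub g (grad (x n)) (grad y)).symm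
    rw [← integral_finsetSum]
    · refine integral_congr_ae (Eventually.of_forall fun t => ?_)
      simp [PiLp.inner_apply]
    · intro i _
      exact (hgi i).bdd_mul
        ((Lp.memLp (grad (x n) - grad y)).inner_const (EuclideanSpace.single i (1 : ℝ))).1
        ((Lp.memLp (grad (x n) - grad y)).inner_const (EuclideanSpace.single i (1 : ℝ))).ae_norm_le

/-! ### Level convexity -/

theorem IsLSC.le_of_tendsto {X : Type} {τ : TopologicalSpace X} {F : X → EReal}
    (h : IsLSC τ F) {x : ℕ → X} {y : X} (hx : Tendsto x atTop (𝓝 y)) {t : ℝ}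
    (ht : ∀ n, F (x n) ≤ t) : F y ≤ t :=
  (h t).mem_of_tendsto hx (Eventually.of_forall ht)

theorem IsLSC.le_of_tendsto_of_sequential {X : Type} {τ : TopologicalSpace X} {F : X → EReal}
    (h : IsLSC (sequentialTopology τ) F) {x : ℕ → X} {y : X} (hx : Tendsto x atTop (𝓝 y)) {t : ℝ}
    (ht : ∀ n, F (x n) ≤ t) : F y ≤ t := by
  -- The open sets of `sequentialTopology τ` are by definition those with sequentially closed
  -- complement.
  have h1 := (@isOpen_compl_iff _ _ (sequentialTopology τ)).2 (h t)
  have h2 : IsSeqClosed {x | F x ≤ (t : EReal)}ᶜᶜ := h1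
  rw [compl_compl] at h2
  exact h2 (x := x) ht hx

theorem supremalFunctional_le_iff {f : Euc N × Euc N → EReal} {u : W1infty Ω} {t : EReal} :
    supremalFunctional Ω f u ≤ t ↔ ∀ᵐ x ∂volume.restrict Ω, f (x, grad u x) ≤ t :=
  ⟨fun h => (ae_le_essSup).mono fun _ hx => hx.trans h, fun h => essSup_le_of_ae_le t h⟩

/-- A gradient alternating between `Du` and `Dv` produces a sequence converging to
`θ u + (1 - θ) v`. -/
theorem exists_seq_grad_eq_or_eq (hΩ : IsOpen Ω) (hb : Bornology.IsBounded Ω)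
    {θ : ℝ} (h0 : 0 ≤ θ) (h1 : θ ≤ 1) (u v : W1infty Ω) :
    ∃ w : ℕ → W1infty Ω,
      (∀ n, ∀ᵐ x ∂volume.restrict Ω, grad (w n) x = grad u x ∨ grad (w n) x = grad v x) ∧
      Tendsto w atTop (@nhds _ (uniformTopology Ω) (θ • u + (1 - θ) • v)) ∧
      Tendsto w atTop (@nhds _ (weakStarTopology Ω) (θ • u + (1 - θ) • v)) := by
  obtain ⟨E, hE, hEθ⟩ := exists_isClosed_abs_integral_indicator_sub_le h0 h1
  -- The oscillation frequency, shifted by one to be positive.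
  let c : ℕ → ℝ := fun n => n + 1
  have hc : ∀ n, 0 < c n := fun n => by positivity
  choose y hyf hyg using fun n =>
    W1infty.exists_comp_integral_indicator hΩ (c n • (u - v)) hE
  let w : ℕ → W1infty Ω := fun n => v + (c n)⁻¹ • y n
  have hsub : ∀ n, w n - (θ • u + (1 - θ) • v)
      = (c n)⁻¹ • (y n - θ • (c n • (u - v))) := by
    intro n
    simp only [w]
    rw [smul_sub, smul_comm θ (c n), inv_smul_smul₀ (hc n).ne']
    module
  have hf : ∀ n, ‖fn (w n) - fn (θ • u + (1 - θ) • v)‖ ≤ (c n)⁻¹ * 2 := by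
    intro n
    change ‖fn (w n - (θ • u + (1 - θ) • v))‖ ≤ _
    rw [hsub n]
    change ‖(c n)⁻¹ • (fn (y n) - θ • fn (c n • (u - v)))‖ ≤ _
    rw [norm_smul, Real.norm_of_nonneg (inv_pos.2 (hc n)).le]
    refine mul_le_mul_of_nonneg_left ?_ (inv_pos.2 (hc n)).le
    refine Lp.norm_top_le_of_ae_bound zero_le_two ?_
    filter_upwards [hyf n, Lp.coeFn_sub (fn (y n)) (θ • fn (c n • (u - v))),
      Lp.coeFn_smul θ (fn (c n • (u - v)))] with x h2 h3 h4
    rw [h3, Pi.sub_apply, h2, h4, Pi.smul_apply, smul_eq_mul]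
    exact hEθ _
  have hgrad : ∀ n, ∀ᵐ x ∂volume.restrict Ω, grad (w n) x
      = grad v x + E.indicator (1 : ℝ → ℝ) (fn (c n • (u - v)) x) • (grad u x - grad v x) := by
    intro n
    have e1 : grad (w n) = grad v + (c n)⁻¹ • grad (y n) := rfl
    have e2 : grad (c n • (u - v)) = c n • (grad u - grad v) := rfl
    have h := hyg n
    rw [e2] at h
    rw [e1]
    filter_upwards [h, Lp.coeFn_add (grad v) ((c n)⁻¹ • grad (y n)),
      Lp.coeFn_smul (c n)⁻¹ (grad (y n)), Lp.coeFn_smul (c n) (grad u - grad v),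
      Lp.coeFn_sub (grad u) (grad v)] with x a1 a2 a3 a4 a5
    rw [a2, Pi.add_apply, a3, Pi.smul_apply, a1, a4, Pi.smul_apply, a5, Pi.sub_apply,
      smul_comm, inv_smul_smul₀ (hc n).ne']
  have hor : ∀ n, ∀ᵐ x ∂volume.restrict Ω,
      grad (w n) x = grad u x ∨ grad (w n) x = grad v x := by
    intro n
    filter_upwards [hgrad n] with x hx
    by_cases hxE : fn (c n • (u - v)) x ∈ E
    · exact Or.inl (by rw [hx]; simp [hxE])
    · exact Or.inr (by rw [hx]; simp [hxE])
  have hlim : Tendsto (fun n => ‖fn (w n) - fn (θ • u + (1 - θ) • v)‖) atTop (𝓝 0) := by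
    refine squeeze_zero (fun n => norm_nonneg _) hf ?_
    have := tendsto_one_div_add_atTop_nhds_zero_nat.mul_const (2 : ℝ)
    simpa [c] using this
  have hbd : ∀ n, ‖grad (w n) - grad (θ • u + (1 - θ) • v)‖
      ≤ ‖grad u‖ + ‖grad v‖ + ‖grad (θ • u + (1 - θ) • v)‖ := by
    intro n
    refine (norm_sub_le _ _).trans (add_le_add ?_ le_rfl)
    refine Lp.norm_top_le_of_ae_bound (by positivity) ?_
    filter_upwards [hor n, (Lp.memLp (grad u)).ae_norm_le, (Lp.memLp (grad v)).ae_norm_le]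
      with x h2 h3 h4
    have h5 := norm_nonneg (grad u)
    have h6 := norm_nonneg (grad v)
    rw [← Lp.norm_def] at h3 h4
    rcases h2 with h2 | h2 <;> rw [h2] <;> linarith
  refine ⟨w, hor, ?_, tendsto_weakStarTopology hΩ hb hlim hbd⟩
  rw [nhds_induced, tendsto_comap_iff]
  exact tendsto_iff_norm_sub_tendsto_zero.2 hlim

end Supremal

theorem mainTheorem3 (N : ℕ) (Ω : Set (Supremal.Euc N))
    (hΩ_open : IsOpen Ω) (hΩ_bdd : Bornology.IsBounded Ω) (hΩ_conn : IsConnected Ω)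
    (hΩ_lip : Supremal.HasLipschitzBoundary Ω)
    (f : Supremal.Euc N × Supremal.Euc N → EReal)
    (hf : Measurable (fun p : Ω × Supremal.Euc N => f ((p.1 : Supremal.Euc N), p.2)))
    (hH : Supremal.HasContinuousMinimizingSequence hΩ_bdd (Supremal.supremalFunctional Ω f))
    (hlsc : Supremal.IsLSC (Supremal.uniformTopology Ω) (Supremal.supremalFunctional Ω f) ∨
      Supremal.IsLSC (Supremal.weakStarTopology Ω) (Supremal.supremalFunctional Ω f) ∨
      Supremal.IsLSC (Supremal.sequentialTopology (Supremal.weakStarTopology Ω))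
        (Supremal.supremalFunctional Ω f)) :
    Supremal.LevelConvex (Supremal.supremalFunctional Ω f) := by
  intro θ h0 h1 u v
  obtain ⟨w, hor, hu, hw⟩ := Supremal.exists_seq_grad_eq_or_eq hΩ_open hΩ_bdd h0.le h1.le u v
  -- Lower semicontinuity is a condition on the finite levels only, so a real level `t` above the
  -- maximum is fixed first.
  refine EReal.le_of_forall_lt_iff_le.1 fun t ht => ?_
  have hF : ∀ n, Supremal.supremalFunctional Ω f (w n) ≤ t := by
    intro n
    rw [Supremal.supremalFunctional_le_iff]
    filter_upwards [hor n,
      Supremal.supremalFunctional_le_iff.1 ((le_max_left _ _).trans ht.le),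
      Supremal.supremalFunctional_le_iff.1 ((le_max_right _ _).trans ht.le)] with x hx h2 h3
    rcases hx with hx | hx <;> rw [hx]
    exacts [h2, h3]
  rcases hlsc with h | h | h
  exacts [h.le_of_tendsto hu hF, h.le_of_tendsto hw hF, h.le_of_tendsto_of_sequential hw hF]
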